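/- Let $\mathbb K$ be $\mathbb R$ or $\mathbb C$ ("analytic" meaning $\mathbb K$-analytic), let $U\subseteq\mathbb K^n$ be nonempty, open and connected, let $f:U\to\mathbb K^n$ be analytic, and let $U^*\subseteq U$ be nonempty, open and connected. For analytic vector fields $g,h$ put $[g,h](x):=Dh(x)g(x)-Dg(x)h(x)$. Let $M(U^*)$ be the field of meromorphic functions on $U^*$, i.e. of functions that can locally be written as quotients of analytic functions with denominator not identically zero (identities between such functions are understood on open dense subsets). A first integral of a vector field $h$ on an open set $V$ is a nonconstant analytic function $\psi:V\to\mathbb K$ with $D\psi(x)h(x)=0$ for all $x\in V$. Let $1\le r<n$, and let $h_1,\ldots,h_r:U^*\to\mathbb K^n$ be analytic with $[h_i,f]=0$ on $U^*$ for all $i$, and linearly independent over $M(U^*)$. Assume that $$[h_i,h_k]=\sum_{\ell=1}^r\mu_{ik\ell}\,h_\ell\quad(1\le i,k\le r)\qquad\text{with }\mu_{ik\ell}\in M(U^*),$$ and define $$\widehat U:=\{y\in U^*:\ h_1(y),\ldots,h_r(y)\text{ are linearly independent in }\mathbb K^n\}.$$ Then every point of $\widehat U$ has an open connected neighborhood $\widehat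 V\subseteq\widehat U$ for which there are analytic functions $\varphi_1,\ldots,\varphi_{n-r}:\widehat V\to\mathbb K$, functionally independent in the sense that $D\varphi_1(x),\ldots,D\varphi_{n-r}(x)$ are linearly independent for every $x\in\widehat V$, such that: (a) every $\varphi_j$ is a common first integral of $h_1,\ldots,h_r$ on $\widehat V$; (b) for every common first integral $\psi$ of $h_1,\ldots,h_r$ on $\widehat V$ there is a $\mathbb K$-valued function $\sigma$ of $n-r$ variables, analytic at every point of $(\varphi_1,\ldots,\varphi_{n-r})(\widehat V)\subseteq\mathbb K^{n-r}$, such that $\psi=\sigma(\varphi_1,\ldots,\varphi_{n-r})$ on $\widehat V$. -/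

import Mathlib

namespace AnalyticVectorField

variable {𝕜 : Type*} [RCLike 𝕜] {n : ℕ}

/-- `P` holds at every point of some open dense subset of `U`. -/
def HoldsGenerically (U : Set (Fin n → 𝕜)) (P : (Fin n → 𝕜) → Prop) : Prop :=
  ∃ W : Set (Fin n → 𝕜), IsOpen W ∧ W ⊆ U ∧ U ⊆ closure W ∧ ∀ x ∈ W, P x

/-- `μ` represents a meromorphic function on `U`: near each point of `U` it is a quotient `a / b` of
analytic functions, `b` not vanishing identically near that point. The values of `μ` where the
denominator vanishes carry no information; accordingly, two representatives define the same
meromorphic function on `U` when they agree on an open dense subset of `U`, and identities between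
meromorphic functions are expressed by `HoldsGenerically`. -/
def IsMeromorphic (U : Set (Fin n → 𝕜)) (μ : (Fin n → 𝕜) → 𝕜) : Prop :=
  ∀ x ∈ U, ∃ a b : (Fin n → 𝕜) → 𝕜, AnalyticAt 𝕜 a x ∧ AnalyticAt 𝕜 b x ∧
    (¬ ∀ᶠ y in nhds x, b y = 0) ∧ ∀ᶠ y in nhds x, b y ≠ 0 → μ y = a y / b y

/-- The vector fields `h₁, …, hᵣ` are linearly independent over the meromorphic functions on `U`. -/
def LinearIndependentOverMeromorphic {r : ℕ} (U : Set (Fin n → 𝕜))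
    (h : Fin r → (Fin n → 𝕜) → (Fin n → 𝕜)) : Prop :=
  ∀ α : Fin r → (Fin n → 𝕜) → 𝕜, (∀ i, IsMeromorphic U (α i)) →
    HoldsGenerically U (fun x => ∑ i, α i x • h i x = 0) →
    ∀ i, HoldsGenerically U (fun x => α i x = 0)

/-- The centralizer of `f` on the open set `U`: the analytic vector fields `h` on `U` with
`[h, f] = 0`, where `[h, f](x) = Df(x) h(x) - Dh(x) f(x)`. -/
def centralizer (U : Set (Fin n → 𝕜)) (f : (Fin n → 𝕜) → (Fin n → 𝕜)) :
    Set ((Fin n → 𝕜) → (Fin n → 𝕜)) :=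
  {h | AnalyticOnNhd 𝕜 h U ∧ ∀ x ∈ U, VectorField.lieBracket 𝕜 h f x = 0}

/-- The Lie derivative `X_h(ψ)(x) = Dψ(x) h(x)`. -/
noncomputable def lieDerivative (h : (Fin n → 𝕜) → (Fin n → 𝕜)) (ψ : (Fin n → 𝕜) → 𝕜)
    (x : Fin n → 𝕜) : 𝕜 :=
  fderiv 𝕜 ψ x (h x)

/-- `ψ` is a first integral of the vector field `h` on `V`: it is analytic and nonconstant on `V`,
and its Lie derivative along `h` vanishes on `V`. -/
structure IsFirstIntegral (V : Set (Fin n → 𝕜)) (h : (Fin n → 𝕜) → (Fin n → 𝕜))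
    (ψ : (Fin n → 𝕜) → 𝕜) : Prop where
  analytic : AnalyticOnNhd 𝕜 ψ V
  nonconstant : ¬ ∃ c : 𝕜, ∀ x ∈ V, ψ x = c
  lieDerivative_eq_zero : ∀ x ∈ V, lieDerivative h ψ x = 0

/-- `ψ` is a common first integral of `h₁, …, hᵣ` on `V`. -/
def IsCommonFirstIntegral {r : ℕ} (V : Set (Fin n → 𝕜)) (h : Fin r → (Fin n → 𝕜) → (Fin n → 𝕜))
    (ψ : (Fin n → 𝕜) → 𝕜) : Prop :=
  ∀ i, IsFirstIntegral V (h i) ψ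

/-- `φ₁, …, φₘ` are functionally independent on `V`: their differentials are linearly independent
at every point of `V`. -/
def FunctionallyIndependent {m : ℕ} (V : Set (Fin n → 𝕜)) (φ : Fin m → (Fin n → 𝕜) → 𝕜) : Prop :=
  ∀ x ∈ V, LinearIndependent 𝕜 (fun j => fderiv 𝕜 (φ j) x)

/-- The set of points of `U` at which the vectors `h₁(y), …, hᵣ(y)` are linearly independent. -/
def independenceSet {r : ℕ} (U : Set (Fin n → 𝕜)) (h : Fin r → (Fin n → 𝕜) → (Fin n → 𝕜)) :
    Set (Fin n → 𝕜) :=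
  {y ∈ U | LinearIndependent 𝕜 (fun i => h i y)}

end AnalyticVectorField

/-! This is the analytic Frobenius theorem, with first integrals as the transverse coordinates. The
meromorphic bracket relations hold on a dense set; near a point of independence, analyticity extends
membership of the brackets in the span to all nearby points.

Inverting a matrix replaces the `h j` near `y` by a frame `X i` of the same span with `L (X i)` the
constant vector `eᵢ`. Then `L` kills every bracket `[X i, X k]`; since this bracket lies in the
span, where `L` is injective, the `X i` commute (`exists_commuting_frame`).

No flow is used. If `ℓ (X x) = 1` and `τ x = ℓ (x - y)`, the Lie series `∑ (-τ)ᵏ / k! · Xᵏ g`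
telescopes to zero under `X` and agrees with `g` on `τ = 0` (`exists_firstIntegral`). Applying this
for each `X i` in turn to the components of a linear map complementary to `L` gives `n - r` common
first integrals `φ`, and `(L, φ)` is a chart (`exists_frobenius_chart`). In this chart a common
first integral has no derivative in the `L`-directions, so on a product of balls it is a function of
`φ` alone.

Over `ℝ`, uniform limits of analytic functions need not be analytic. All estimates therefore bound
sums of coefficient norms (`MajorizedAt`), which treats `ℝ` and `ℂ` alike. -/

open Set Filter Topology

/-! ### Calculus of power series with majorized coefficients. -/

namespace AnalyticMajorant

variable {𝕜 : Type*} [RCLike 𝕜]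
  {E : Type*} [NormedAddCommGroup E] [NormedSpace 𝕜 E]
  {F : Type*} [NormedAddCommGroup F] [NormedSpace 𝕜 F]
  {G : Type*} [NormedAddCommGroup G] [NormedSpace 𝕜 G]
  {G' : Type*} [NormedAddCommGroup G'] [NormedSpace 𝕜 G']

/-- `g` has a power series expansion `∑ pₖ` on the ball of radius `ρ` around `y`, and
`∑ ‖pₖ‖ ρᵏ ≤ C`. -/
def MajorizedAt (𝕜 : Type*) [RCLike 𝕜] {E : Type*} [NormedAddCommGroup E] [NormedSpace 𝕜 E]
    {F : Type*} [NormedAddCommGroup F] [NormedSpace 𝕜 F] (g : E → F) (y : E) (ρ C : ℝ) : Prop :=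
  ∃ p : FormalMultilinearSeries 𝕜 E F, HasFPowerSeriesOnBall g p y (ENNReal.ofReal ρ) ∧
    ∀ N, ∑ k ∈ Finset.range N, ‖p k‖ * ρ ^ k ≤ C

variable {g : E → F} {y : E} {ρ ρ' C C' : ℝ}

theorem MajorizedAt.pos (h : MajorizedAt 𝕜 g y ρ C) : 0 < ρ := by
  obtain ⟨p, hp, -⟩ := h
  simpa using hp.r_pos

theorem MajorizedAt.nonneg (h : MajorizedAt 𝕜 g y ρ C) : 0 ≤ C := by
  obtain ⟨p, -, hp⟩ := h
  simpa using hp 0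

theorem majorizedAt_of_hasSum (hρ : 0 < ρ) (p : FormalMultilinearSeries 𝕜 E F)
    (hp : ∀ N, ∑ k ∈ Finset.range N, ‖p k‖ * ρ ^ k ≤ C)
    (hg : ∀ z, ‖z‖ < ρ → HasSum (fun k => p k fun _ => z) (g (y + z))) :
    MajorizedAt 𝕜 g y ρ C := by
  refine ⟨p, ⟨?_, by simpa using hρ, fun {z} hz => hg z ?_⟩, hp⟩
  · refine p.le_radius_of_bound C (r := ρ.toNNReal) fun k => ?_
    rw [Real.coe_toNNReal _ hρ.le]
    refine le_trans ?_ (hp (k + 1))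
    exact Finset.single_le_sum (f := fun k => ‖p k‖ * ρ ^ k) (fun i _ => by positivity)
      (Finset.self_mem_range_succ k)
  · rwa [Metric.eball_ofReal, mem_ball_zero_iff] at hz

theorem MajorizedAt.exists_hasSum (h : MajorizedAt 𝕜 g y ρ C) :
    ∃ p : FormalMultilinearSeries 𝕜 E F, Summable (fun k => ‖p k‖ * ρ ^ k) ∧
      ∑' k, ‖p k‖ * ρ ^ k ≤ C ∧
      ∀ z, ‖z‖ < ρ → HasSum (fun k => p k fun _ => z) (g (y + z)) := by
  have hρ := h.pos
  obtain ⟨p, hp, hC⟩ := h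
  have hnn : ∀ k, 0 ≤ ‖p k‖ * ρ ^ k := fun k => by positivity
  refine ⟨p, summable_of_sum_range_le hnn hC, Real.tsum_le_of_sum_range_le hnn hC,
    fun z hz => hp.hasSum ?_⟩
  rwa [Metric.eball_ofReal, mem_ball_zero_iff]

theorem majorizedAt_of_summable (hρ : 0 < ρ) (p : FormalMultilinearSeries 𝕜 E F)
    (hp : Summable fun k => ‖p k‖ * ρ ^ k) (hC : ∑' k, ‖p k‖ * ρ ^ k ≤ C)
    (hg : ∀ z, ‖z‖ < ρ → HasSum (fun k => p k fun _ => z) (g (y + z))) :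
    MajorizedAt 𝕜 g y ρ C :=
  majorizedAt_of_hasSum hρ p
    (fun _ => (hp.sum_le_tsum _ fun i _ => by positivity).trans hC) hg

theorem MajorizedAt.mono (h : MajorizedAt 𝕜 g y ρ C) (hρ' : 0 < ρ') (hρ : ρ' ≤ ρ) (hC : C ≤ C') :
    MajorizedAt 𝕜 g y ρ' C' := by
  obtain ⟨p, hp, hp'⟩ := h
  refine ⟨p, hp.mono (by simpa using hρ') (ENNReal.ofReal_le_ofReal hρ), fun N => ?_⟩
  refine le_trans (Finset.sum_le_sum fun k _ => ?_) ((hp' N).trans hC)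
  gcongr

theorem MajorizedAt.analyticOnNhd [CompleteSpace F] (h : MajorizedAt 𝕜 g y ρ C) :
    AnalyticOnNhd 𝕜 g (Metric.ball y ρ) := by
  obtain ⟨p, hp, -⟩ := h
  have := hp.analyticOnNhd
  rwa [Metric.eball_ofReal] at this

theorem norm_apply_const_le (p : FormalMultilinearSeries 𝕜 E F) (k : ℕ) {z : E} (hz : ‖z‖ < ρ) :
    ‖p k fun _ => z‖ ≤ ‖p k‖ * ρ ^ k := by
  refine ((p k).le_opNorm _).trans ?_
  simp only [Finset.prod_const, Finset.card_univ, Fintype.card_fin]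
  gcongr

theorem summable_norm_apply_const {p : FormalMultilinearSeries 𝕜 E F}
    (hp : Summable fun k => ‖p k‖ * ρ ^ k) {z : E} (hz : ‖z‖ < ρ) :
    Summable fun k => ‖p k fun _ => z‖ :=
  hp.of_nonneg_of_le (fun _ => norm_nonneg _) fun k => norm_apply_const_le p k hz

theorem MajorizedAt.norm_le (h : MajorizedAt 𝕜 g y ρ C) {x : E} (hx : x ∈ Metric.ball y ρ) :
    ‖g x‖ ≤ C := by
  obtain ⟨p, hs, hC, hp⟩ := h.exists_hasSum
  have hz : ‖x - y‖ < ρ := by rwa [← dist_eq_norm]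
  have h1 := hp (x - y) hz
  rw [add_sub_cancel] at h1
  rw [← h1.tsum_eq]
  exact (tsum_of_norm_bounded hs.hasSum fun k => norm_apply_const_le p k hz).trans hC

theorem exists_majorizedAt_of_analyticAt (h : AnalyticAt 𝕜 g y) :
    ∃ ρ C, 0 < ρ ∧ MajorizedAt 𝕜 g y ρ C := by
  obtain ⟨p, r, hp⟩ := h
  obtain ⟨ρ, hρ0, hρ⟩ := ENNReal.lt_iff_exists_nnreal_btwn.1 hp.r_pos
  have hs := p.summable_norm_mul_pow (hρ.trans_le hp.r_le)
  refine ⟨ρ, ∑' k, ‖p k‖ * (ρ : ℝ) ^ k, by simpa using hρ0, p,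
    hp.mono (by simpa using hρ0) (by simpa using hρ.le), fun N => ?_⟩
  exact hs.sum_le_tsum _ fun i _ => by positivity

/-- The factor counts the `k`-element subsets of `k + 1` slots, over which the re-expansion of `p (k
+ 1)` is summed. -/
theorem norm_derivSeries_le (p : FormalMultilinearSeries 𝕜 E F) (k : ℕ) :
    ‖p.derivSeries k‖ ≤ (k + 1) * ‖p (k + 1)‖ := by
  have h1 : ‖p.derivSeries k‖ ≤ ‖p.changeOriginSeries 1 k‖ := by
    refine (ContinuousLinearMap.norm_compContinuousMultilinearMap_le _ _).trans ?_
    refine mul_le_of_le_one_left (norm_nonneg _) ?_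
    exact (continuousMultilinearCurryFin1 𝕜 E F).toLinearIsometry.norm_toContinuousLinearMap_le
  have h2 := p.nnnorm_changeOriginSeries_le_tsum 1 k
  rw [tsum_fintype, Finset.sum_const, Finset.card_univ, Fintype.card_finset_len,
    Fintype.card_fin, nsmul_eq_mul, add_comm 1 k, Nat.choose_succ_self_right] at h2
  refine h1.trans ?_
  have h3 : ‖p.changeOriginSeries 1 k‖ ≤ ((k + 1 : ℕ) : ℝ) * ‖p (k + 1)‖ := by exact_mod_cast h2
  simpa using h3

/-- A Cauchy estimate on coefficients, without contour integrals: shrinking the radius pays for the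
factor `k + 1`. -/
theorem MajorizedAt.fderiv [CompleteSpace F] (h : MajorizedAt 𝕜 g y ρ C) (hρ' : 0 < ρ')
    (hlt : ρ' < ρ) : MajorizedAt 𝕜 (fderiv 𝕜 g) y ρ' (C / (ρ - ρ')) := by
  have hρ := h.pos
  obtain ⟨p, hp, hC⟩ := h
  refine ⟨p.derivSeries, hp.fderiv.mono (by simpa using hρ')
    (ENNReal.ofReal_le_ofReal hlt.le), fun N => ?_⟩
  rw [le_div_iff₀ (sub_pos.2 hlt), Finset.sum_mul]
  refine le_trans (Finset.sum_le_sum (g := fun k => ‖p (k + 1)‖ * ρ ^ (k + 1)) fun k _ => ?_)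
    (le_trans ?_ (hC (N + 1)))
  -- Bernoulli's inequality for `(ρ / ρ') ^ (k + 1)`, multiplied by `ρ' ^ (k + 1)`.
  · have hpow : ((k : ℝ) + 1) * ρ' ^ k * (ρ - ρ') ≤ ρ ^ (k + 1) := by
      have hb := one_add_mul_sub_le_pow (a := ρ / ρ') (n := k + 1)
        (by have : 0 ≤ ρ / ρ' := by positivity
            linarith)
      rw [div_pow, le_div_iff₀ (by positivity)] at hb
      have : ((1 : ℝ) + ((k + 1 : ℕ) : ℝ) * (ρ / ρ' - 1)) * ρ' ^ (k + 1)
          = ρ' ^ (k + 1) + (k + 1) * ρ' ^ k * (ρ - ρ') := by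
        push_cast
        field_simp
        ring
      rw [this] at hb
      have : 0 ≤ ρ' ^ (k + 1) := by positivity
      linarith
    calc ‖p.derivSeries k‖ * ρ' ^ k * (ρ - ρ')
        ≤ ((k + 1) * ‖p (k + 1)‖) * ρ' ^ k * (ρ - ρ') := by
          have := sub_nonneg.2 hlt.le
          gcongr
          exact norm_derivSeries_le p k
      _ = ‖p (k + 1)‖ * ((k + 1) * ρ' ^ k * (ρ - ρ')) := by ring
      _ ≤ _ := by gcongr
  · rw [Finset.sum_range_succ']
    simp

/-- Only diagonal values matter, so any distribution of the slots will do: the first `i` feed `p`,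
the others `q`. The free degree `k` spares casts in the Cauchy product. -/
theorem exists_multilinear_bilinear (b : F →L[𝕜] G →L[𝕜] G') {i j k : ℕ} (hk : i + j = k)
    (p : E [×i]→L[𝕜] F) (q : E [×j]→L[𝕜] G) :
    ∃ m : E [×k]→L[𝕜] G', ‖m‖ ≤ ‖b‖ * (‖p‖ * ‖q‖) ∧
      ∀ x, (m fun _ => x) = b (p fun _ => x) (q fun _ => x) := by
  subst hk
  let s : Finset (Fin (i + j)) := Finset.univ.map (Fin.castAddEmb j)
  have hs : s.card = i := by simp [s]
  have hs' : sᶜ.card = j := by simp [Finset.card_compl, hs]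
  let c : F →L[𝕜] (E [×j]→L[𝕜] G') :=
    ((ContinuousLinearMap.compContinuousMultilinearMapL 𝕜 (fun _ : Fin j => E) G G').flip q).comp b
  have hc : ∀ v, c v = (b v).compContinuousMultilinearMap q := fun v => rfl
  refine ⟨(ContinuousMultilinearMap.curryFinFinset 𝕜 E G' hs hs').symm
    (c.compContinuousMultilinearMap p), ?_, fun x => ?_⟩
  · rw [LinearIsometryEquiv.norm_map]
    refine (ContinuousLinearMap.norm_compContinuousMultilinearMap_le _ _).trans ?_
    have : ‖c‖ ≤ ‖b‖ * ‖q‖ := by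
      refine ContinuousLinearMap.opNorm_le_bound _ (by positivity) fun v => ?_
      rw [hc]
      refine (ContinuousLinearMap.norm_compContinuousMultilinearMap_le _ _).trans ?_
      calc ‖b v‖ * ‖q‖ ≤ (‖b‖ * ‖v‖) * ‖q‖ := by gcongr; exact b.le_opNorm v
        _ = _ := by ring
    calc ‖c‖ * ‖p‖ ≤ (‖b‖ * ‖q‖) * ‖p‖ := by gcongr
      _ = _ := by ring
  · rw [ContinuousMultilinearMap.curryFinFinset_symm_apply_const]
    rfl

/-- The expansion is the Cauchy product of the two series; `‖b‖ ≤ 1` lets the bounds simply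
multiply. -/
theorem MajorizedAt.bilinear [CompleteSpace F] [CompleteSpace G] [CompleteSpace G']
    {g' : E → G} (b : F →L[𝕜] G →L[𝕜] G') (hb : ‖b‖ ≤ 1)
    (h : MajorizedAt 𝕜 g y ρ C) (h' : MajorizedAt 𝕜 g' y ρ C') :
    MajorizedAt 𝕜 (fun x => b (g x) (g' x)) y ρ (C * C') := by
  have hρ := h.pos
  have hC0 := h.nonneg
  obtain ⟨p, hps, hpC, hp⟩ := h.exists_hasSum
  obtain ⟨q, hqs, hqC, hq⟩ := h'.exists_hasSum
  have hm : ∀ k (ij : Finset.HasAntidiagonal.antidiagonal k), ∃ m : E [×k]→L[𝕜] G',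
      ‖m‖ ≤ ‖b‖ * (‖p ij.1.1‖ * ‖q ij.1.2‖) ∧
      ∀ x, (m fun _ => x) = b (p ij.1.1 fun _ => x) (q ij.1.2 fun _ => x) := fun k ij =>
    exists_multilinear_bilinear b (Finset.HasAntidiagonal.mem_antidiagonal.1 ij.2) _ _
  choose m hm1 hm2 using hm
  have hnorm : ∀ k, ‖∑ ij : Finset.HasAntidiagonal.antidiagonal k, m k ij‖ * ρ ^ k ≤
      ∑ ij ∈ Finset.HasAntidiagonal.antidiagonal k,
        (‖p ij.1‖ * ρ ^ ij.1) * (‖q ij.2‖ * ρ ^ ij.2) := fun k => by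
    rw [← Finset.sum_coe_sort (Finset.HasAntidiagonal.antidiagonal k)]
    calc _ ≤ (∑ ij : Finset.HasAntidiagonal.antidiagonal k, ‖m k ij‖) * ρ ^ k := by
          gcongr
          exact norm_sum_le _ _
      _ = ∑ ij : Finset.HasAntidiagonal.antidiagonal k, ‖m k ij‖ * ρ ^ k := Finset.sum_mul _ _ _
      _ ≤ _ := Finset.sum_le_sum fun ij _ => ?_
    have hij := Finset.HasAntidiagonal.mem_antidiagonal.1 ij.2
    calc ‖m k ij‖ * ρ ^ k ≤ (1 * (‖p ij.1.1‖ * ‖q ij.1.2‖)) * ρ ^ k := by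
          gcongr
          exact (hm1 k ij).trans (by gcongr)
      _ = ‖p ij.1.1‖ * ‖q ij.1.2‖ * ρ ^ (ij.1.1 + ij.1.2) := by rw [one_mul, hij]
      _ = _ := by rw [pow_add]; ring
  have hps' : Summable fun k => ‖‖p k‖ * ρ ^ k‖ := by
    simpa only [Real.norm_eq_abs] using hps.abs
  have hqs' : Summable fun k => ‖‖q k‖ * ρ ^ k‖ := by
    simpa only [Real.norm_eq_abs] using hqs.abs
  have hprod := summable_norm_sum_mul_antidiagonal_of_summable_norm hps' hqs'
  have hprod' : Summable fun k => ∑ ij ∈ Finset.HasAntidiagonal.antidiagonal k,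
      (‖p ij.1‖ * ρ ^ ij.1) * (‖q ij.2‖ * ρ ^ ij.2) := hprod.of_norm
  have hsm : Summable fun k => ‖∑ ij : Finset.HasAntidiagonal.antidiagonal k, m k ij‖ * ρ ^ k :=
    hprod'.of_nonneg_of_le (fun k => by positivity) hnorm
  refine majorizedAt_of_summable hρ (fun k => ∑ ij : Finset.HasAntidiagonal.antidiagonal k, m k ij) hsm ?_
    fun z hz => ?_
  · refine (hsm.tsum_le_tsum hnorm hprod').trans ?_
    rw [← tsum_mul_tsum_eq_tsum_sum_antidiagonal_of_summable_norm hps' hqs']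
    gcongr
  · have hpz := summable_norm_apply_const hps hz
    have hqz := summable_norm_apply_const hqs hz
    have hsummable : Summable fun ij : ℕ × ℕ => b (p ij.1 fun _ => z) (q ij.2 fun _ => z) := by
      have hpq : Summable fun ij : ℕ × ℕ => ‖p ij.1 fun _ => z‖ * ‖q ij.2 fun _ => z‖ :=
        Summable.mul_of_nonneg (f := fun k => ‖p k fun _ => z‖) (g := fun k => ‖q k fun _ => z‖)
          hpz hqz (fun k => norm_nonneg (p k fun _ => z)) fun k => norm_nonneg (q k fun _ => z)
      refine Summable.of_norm_bounded hpq fun ij => ?_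
      calc _ ≤ ‖b‖ * ‖p ij.1 fun _ => z‖ * ‖q ij.2 fun _ => z‖ := b.le_opNorm₂ _ _
        _ ≤ 1 * ‖p ij.1 fun _ => z‖ * ‖q ij.2 fun _ => z‖ := by gcongr
        _ = _ := by rw [one_mul]
    have hpair : HasSum (fun ij : ℕ × ℕ => b (p ij.1 fun _ => z) (q ij.2 fun _ => z))
        (b (g (y + z)) (g' (y + z))) := by
      have h1 : ∀ i, HasSum (fun j => b (p i fun _ => z) (q j fun _ => z))
          (b (p i fun _ => z) (g' (y + z))) := fun i => (hq z hz).mapL _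
      have h2 : HasSum (fun i => b (p i fun _ => z) (g' (y + z))) (b (g (y + z)) (g' (y + z))) :=
        (hp z hz).mapL (b.flip (g' (y + z)))
      have h3 := hsummable.hasSum.prod_fiberwise h1
      rw [h2.unique h3]
      exact hsummable.hasSum
    have hsig := (Finset.HasAntidiagonal.sigmaAntidiagonalEquivProd (A := ℕ)).hasSum_iff.2 hpair
    have := hsig.sigma fun k => hasSum_fintype _
    convert this using 2 with k
    rw [sum_apply]
    exact Finset.sum_congr rfl fun ij _ => hm2 k ij z

theorem MajorizedAt.clm_apply [CompleteSpace F] [CompleteSpace G] {L : E → F →L[𝕜] G}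
    (h : MajorizedAt 𝕜 L y ρ C) (h' : MajorizedAt 𝕜 g y ρ C') :
    MajorizedAt 𝕜 (fun x => L x (g x)) y ρ (C * C') :=
  h.bilinear (ContinuousLinearMap.id 𝕜 (F →L[𝕜] G)) ContinuousLinearMap.norm_id_le h'

theorem MajorizedAt.smul [CompleteSpace F] {a : E → 𝕜}
    (h : MajorizedAt 𝕜 a y ρ C) (h' : MajorizedAt 𝕜 g y ρ C') :
    MajorizedAt 𝕜 (fun x => a x • g x) y ρ (C * C') :=
  h.bilinear (ContinuousLinearMap.lsmul 𝕜 𝕜) ContinuousLinearMap.opNorm_lsmul_le h'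

theorem MajorizedAt.const_smul (h : MajorizedAt 𝕜 g y ρ C) (c : 𝕜) :
    MajorizedAt 𝕜 (fun x => c • g x) y ρ (‖c‖ * C) := by
  obtain ⟨p, hp, hC⟩ := h
  refine ⟨c • p, hp.const_smul, fun N => ?_⟩
  have := mul_le_mul_of_nonneg_left (hC N) (norm_nonneg c)
  simpa [norm_smul, Finset.mul_sum, mul_assoc] using this

theorem majorizedAt_clm_sub [CompleteSpace F] (ℓ : E →L[𝕜] F) (y : E) (hρ : 0 < ρ) :
    MajorizedAt 𝕜 (fun x => ℓ (x - y)) y ρ (‖ℓ‖ * ρ) := by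
  have hz : ∀ k, k ≠ 1 → ℓ.fpowerSeries 0 k = 0 := by
    rintro (_ | _ | k) hk
    · ext; simp
    · exact absurd rfl hk
    · rfl
  have h1 : ‖ℓ.fpowerSeries 0 1‖ = ‖ℓ‖ := by
    change ‖(continuousMultilinearCurryFin1 𝕜 E F).symm ℓ‖ = _
    rw [LinearIsometryEquiv.norm_map]
  have hsum : HasSum (fun k => ‖ℓ.fpowerSeries 0 k‖ * ρ ^ k) (‖ℓ‖ * ρ) := by
    have := hasSum_single (f := fun k => ‖ℓ.fpowerSeries 0 k‖ * ρ ^ k) 1 fun k hk => by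
      rw [hz k hk, norm_zero, zero_mul]
    rwa [h1, pow_one] at this
  refine majorizedAt_of_summable hρ (ℓ.fpowerSeries 0) hsum.summable hsum.tsum_eq.le
    fun z _ => ?_
  simpa using (ℓ.hasFPowerSeriesOnBall 0).hasSum (y := z) (by simp)

/-- The double family of coefficient norms is summable, so the terms may be regrouped by degree. -/
theorem MajorizedAt.tsum [CompleteSpace F] {g : ℕ → E → F} {c : ℕ → ℝ} (hρ : 0 < ρ)
    (h : ∀ k, MajorizedAt 𝕜 (g k) y ρ (c k)) (hc : Summable c) :
    MajorizedAt 𝕜 (fun x => ∑' k, g k x) y ρ (∑' k, c k) := by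
  choose p hps hpC hp using fun k => (h k).exists_hasSum
  have hnn : ∀ k m, 0 ≤ ‖p k m‖ * ρ ^ m := fun k m => by positivity
  have hdouble : Summable fun km : ℕ × ℕ => ‖p km.1 km.2‖ * ρ ^ km.2 := by
    refine (summable_prod_of_nonneg fun km => hnn km.1 km.2).2 ⟨hps, ?_⟩
    exact hc.of_nonneg_of_le (fun k => tsum_nonneg (hnn k)) hpC
  have hcol : ∀ m, Summable fun k => ‖p k m‖ * ρ ^ m := fun m =>
    hdouble.comp_injective (i := fun k => (k, m)) fun a b hab => (Prod.mk.inj hab).1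
  have hcol' : ∀ m, Summable fun k => ‖p k m‖ := fun m => by
    have := (hcol m).mul_right (ρ ^ m)⁻¹
    refine this.congr fun k => ?_
    rw [mul_assoc, mul_inv_cancel₀ (by positivity), mul_one]
  have hswap : Summable fun mk : ℕ × ℕ => ‖p mk.2 mk.1‖ * ρ ^ mk.1 :=
    hdouble.comp_injective (i := Prod.swap) Prod.swap_injective
  have hle : ∀ m, ‖∑' k, p k m‖ * ρ ^ m ≤ ∑' k, ‖p k m‖ * ρ ^ m := fun m => by
    rw [tsum_mul_right]
    gcongr
    exact norm_tsum_le_tsum_norm (hcol' m)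
  have hsum : Summable fun m => ‖∑' k, p k m‖ * ρ ^ m :=
    hswap.prod.of_nonneg_of_le (fun m => by positivity) hle
  refine majorizedAt_of_summable hρ (fun m => ∑' k, p k m) hsum ?_ fun z hz => ?_
  · calc _ ≤ ∑' m, ∑' k, ‖p k m‖ * ρ ^ m := hsum.tsum_le_tsum hle hswap.prod
      _ = ∑' k, ∑' m, ‖p k m‖ * ρ ^ m :=
        Summable.tsum_comm (f := fun k m => ‖p k m‖ * ρ ^ m) hdouble
      _ ≤ _ := hdouble.prod.tsum_le_tsum hpC hc
  · have hzs : Summable fun mk : ℕ × ℕ => p mk.2 mk.1 fun _ => z :=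
      Summable.of_norm_bounded hswap fun mk => norm_apply_const_le (p mk.2) mk.1 hz
    have h1 := hzs.hasSum.prod_fiberwise fun m => (hzs.prod_factor m).hasSum
    have h2 : ∑' mk : ℕ × ℕ, (p mk.2 mk.1 fun _ => z) = ∑' k, g k (y + z) := by
      rw [hzs.tsum_prod, Summable.tsum_comm (f := fun k m => p k m fun _ => z)
        (hzs.comp_injective (i := Prod.swap) Prod.swap_injective)]
      exact tsum_congr fun k => (hp k z hz).tsum_eq
    rw [h2] at h1
    convert h1 using 2 with m
    exact (((hcol' m).of_norm).hasSum.mapL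
      (ContinuousMultilinearMap.apply 𝕜 (fun _ : Fin m => E) F fun _ => z)).tsum_eq.symm

end AnalyticMajorant

/-! ### Lie series and first integrals of commuting fields. -/

namespace AnalyticMajorant

variable {𝕜 : Type*} [RCLike 𝕜]
  {E : Type*} [NormedAddCommGroup E] [NormedSpace 𝕜 E]

/-- The derivative of the function `g` along the vector field `X`. -/
noncomputable def dirDeriv (𝕜 : Type*) [RCLike 𝕜] {E : Type*} [NormedAddCommGroup E]
    [NormedSpace 𝕜 E] (X : E → E) (g : E → 𝕜) : E → 𝕜 :=
  fun x => fderiv 𝕜 g x (X x)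

/-- The `k`-th term `(-τ)ᵏ / k! · Xᵏ g` of the Lie series of `g`, where `τ x = ℓ (x - y)`. -/
noncomputable def lieTerm (X : E → E) (ℓ : E →L[𝕜] 𝕜) (y : E) (g : E → 𝕜) (k : ℕ) : E → 𝕜 :=
  fun x => ((-1) ^ k / (k.factorial : 𝕜)) • (ℓ (x - y) ^ k • (dirDeriv 𝕜 X)^[k] g x)

variable {X Y : E → E} {g : E → 𝕜} {ℓ : E →L[𝕜] 𝕜} {x y : E} {ρ ρ' C M : ℝ}

theorem analyticAt_clm_apply {F G : Type*} [NormedAddCommGroup F] [NormedSpace 𝕜 F]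
    [NormedAddCommGroup G] [NormedSpace 𝕜 G] {A : E → F →L[𝕜] G} {u : E → F} {y : E}
    (hA : AnalyticAt 𝕜 A y) (hu : AnalyticAt 𝕜 u y) :
    AnalyticAt 𝕜 (fun x => A x (u x)) y :=
  (ContinuousLinearMap.analyticAt_bilinear (ContinuousLinearMap.id 𝕜 (F →L[𝕜] G)) _).comp₂ hA hu

theorem analyticAt_dirDeriv [CompleteSpace E] (hX : AnalyticAt 𝕜 X y) (hg : AnalyticAt 𝕜 g y) :
    AnalyticAt 𝕜 (dirDeriv 𝕜 X g) y :=
  analyticAt_clm_apply hg.fderiv hX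

theorem analyticAt_dirDeriv_iterate [CompleteSpace E] (hX : AnalyticAt 𝕜 X y)
    (hg : AnalyticAt 𝕜 g y) (k : ℕ) : AnalyticAt 𝕜 ((dirDeriv 𝕜 X)^[k] g) y := by
  induction k with
  | zero => exact hg
  | succ k ih =>
    rw [Function.iterate_succ_apply']
    exact analyticAt_dirDeriv hX ih

theorem majorizedAt_dirDeriv [CompleteSpace E] (hX : MajorizedAt 𝕜 X y ρ M)
    (hg : MajorizedAt 𝕜 g y ρ C) (hρ' : 0 < ρ') (hlt : ρ' < ρ) :
    MajorizedAt 𝕜 (dirDeriv 𝕜 X g) y ρ' (C / (ρ - ρ') * M) :=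
  (hg.fderiv hρ' hlt).clm_apply (hX.mono hρ' hlt.le le_rfl)

/-- The `k` derivatives share the loss of radius `ρ - ρ'` in equal steps, each costing a factor `M *
k / (ρ - ρ')`. The resulting `kᵏ` is offset by the factorial in the Lie series. -/
theorem majorizedAt_dirDeriv_iterate [CompleteSpace E] (hX : MajorizedAt 𝕜 X y ρ M)
    (hg : MajorizedAt 𝕜 g y ρ C) (hρ' : 0 < ρ') (hlt : ρ' < ρ) (k : ℕ) :
    MajorizedAt 𝕜 ((dirDeriv 𝕜 X)^[k] g) y ρ' (C * (M * k / (ρ - ρ')) ^ k) := by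
  rcases k.eq_zero_or_pos with rfl | hk
  · simpa using hg.mono hρ' hlt.le le_rfl
  have hd : 0 < ρ - ρ' := sub_pos.2 hlt
  have hk' : (0 : ℝ) < k := by exact_mod_cast hk
  set δ := (ρ - ρ') / k with hδ
  have hδ0 : 0 < δ := by positivity
  have hkδ : k * δ = ρ - ρ' := by rw [hδ]; field_simp
  have key : ∀ j ≤ k, MajorizedAt 𝕜 ((dirDeriv 𝕜 X)^[j] g) y (ρ - j * δ) (C * (M / δ) ^ j) := by
    intro j
    induction j with
    | zero => intro _; simpa using hg
    | succ j ih =>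
      intro hj
      have hj' : ((j : ℝ) + 1) * δ ≤ k * δ := by
        gcongr
        exact_mod_cast hj
      rw [Function.iterate_succ_apply']
      have hle : ρ - j * δ ≤ ρ := by
        have : 0 ≤ j * δ := by positivity
        linarith
      have h1 := majorizedAt_dirDeriv (ρ' := ρ - (j + 1) * δ)
        (hX.mono (by linarith) hle le_rfl) (ih (by lia)) (by linarith) (by linarith)
      have h2 : ρ - j * δ - (ρ - (j + 1) * δ) = δ := by ring
      rw [h2] at h1
      push_cast
      convert! h1 using 1
      rw [pow_succ]
      ring
  have := key k le_rfl
  rw [hkδ, sub_sub_cancel] at this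
  convert! this using 3
  rw [hδ]
  field_simp

theorem MajorizedAt.pow_smul [CompleteSpace E] (hg : MajorizedAt 𝕜 g y ρ C) (ℓ : E →L[𝕜] 𝕜)
    (k : ℕ) : MajorizedAt 𝕜 (fun x => ℓ (x - y) ^ k • g x) y ρ ((‖ℓ‖ * ρ) ^ k * C) := by
  induction k with
  | zero => simpa using hg
  | succ k ih =>
    convert! (majorizedAt_clm_sub ℓ y hg.pos).smul ih using 1
    · ext x
      simp only [smul_eq_mul]
      ring
    · ring

/-- Since `kᵏ / k! ≤ eᵏ`, the bound is geometric; its ratio is small with `ρ'` because `τ` vanishes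
at `y`. Derivatives are estimated on the fixed radius `ρ / 2`, whence the factor `2 / ρ`. -/
theorem majorizedAt_lieTerm [CompleteSpace E] (hX : MajorizedAt 𝕜 X y ρ M)
    (hg : MajorizedAt 𝕜 g y ρ C) (ℓ : E →L[𝕜] 𝕜) (hρ' : 0 < ρ') (hlt : ρ' ≤ ρ / 2) (k : ℕ) :
    MajorizedAt 𝕜 (lieTerm X ℓ y g k) y ρ'
      (C * (‖ℓ‖ * ρ' * (M * Real.exp 1 * 2 / ρ)) ^ k) := by
  have hρ := hX.pos
  have hM := hX.nonneg
  have hC := hg.nonneg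
  have h1 := ((majorizedAt_dirDeriv_iterate hX hg (ρ' := ρ / 2) (by positivity) (by linarith) k).mono
    hρ' hlt le_rfl).pow_smul ℓ k |>.const_smul ((-1) ^ k / (k.factorial : 𝕜))
  refine h1.mono hρ' le_rfl ?_
  have h2 : ‖((-1) ^ k / (k.factorial : 𝕜))‖ = 1 / k.factorial := by simp
  have h3 : (k : ℝ) ^ k / k.factorial ≤ Real.exp 1 ^ k := by
    rw [← Real.exp_nat_mul, mul_one]
    exact Real.pow_div_factorial_le_exp _ k.cast_nonneg k
  rw [h2]
  calc _ = C * (‖ℓ‖ * ρ' * (M * 2 / ρ)) ^ k * ((k : ℝ) ^ k / k.factorial) := by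
        have : ρ - ρ / 2 = ρ / 2 := by ring
        rw [this]
        simp only [mul_pow, div_pow]
        field_simp
    _ ≤ C * (‖ℓ‖ * ρ' * (M * 2 / ρ)) ^ k * Real.exp 1 ^ k := by gcongr
    _ = _ := by
        rw [mul_assoc, ← mul_pow]
        congr 2
        ring

theorem fderiv_lieTerm_apply {k : ℕ} (hu : DifferentiableAt 𝕜 ((dirDeriv 𝕜 X)^[k] g) x) (w : E) :
    fderiv 𝕜 (lieTerm X ℓ y g k) x w = ((-1) ^ k / (k.factorial : 𝕜)) *
      (k * ℓ (x - y) ^ (k - 1) * ℓ w * (dirDeriv 𝕜 X)^[k] g x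
        + ℓ (x - y) ^ k * fderiv 𝕜 ((dirDeriv 𝕜 X)^[k] g) x w) := by
  have h1 : HasFDerivAt (fun x => ℓ (x - y)) ℓ x :=
    ℓ.hasFDerivAt.comp x ((hasFDerivAt_id x).sub_const y)
  have h2 := ((h1.pow k).smul hu.hasFDerivAt).const_smul ((-1) ^ k / (k.factorial : 𝕜))
  have h3 : HasFDerivAt (lieTerm X ℓ y g k) _ x := h2
  rw [h3.fderiv]
  simp
  ring

theorem fderiv_lieTerm_zero_apply_self (hu : DifferentiableAt 𝕜 g x) :
    fderiv 𝕜 (lieTerm X ℓ y g 0) x (X x) = lieTerm X ℓ y (dirDeriv 𝕜 X g) 0 x := by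
  rw [fderiv_lieTerm_apply (by simpa using hu)]
  simp [lieTerm, dirDeriv]

/-- As `X τ = 1`, differentiating the power of `τ` lowers its degree and gives minus the previous
term of the Lie series of `X g`. This is the source of the telescoping. -/
theorem fderiv_lieTerm_succ_apply_self {k : ℕ}
    (hu : DifferentiableAt 𝕜 ((dirDeriv 𝕜 X)^[k + 1] g) x) (hℓ : ℓ (X x) = 1) :
    fderiv 𝕜 (lieTerm X ℓ y g (k + 1)) x (X x) =
      lieTerm X ℓ y (dirDeriv 𝕜 X g) (k + 1) x - lieTerm X ℓ y (dirDeriv 𝕜 X g) k x := by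
  rw [fderiv_lieTerm_apply hu, hℓ]
  have h1 : fderiv 𝕜 ((dirDeriv 𝕜 X)^[k + 1] g) x (X x) =
      (dirDeriv 𝕜 X)^[k + 1] (dirDeriv 𝕜 X g) x := by
    rw [← Function.iterate_succ_apply, Function.iterate_succ_apply' _ (k + 1)]
    rfl
  have h2 : ((k + 1).factorial : 𝕜) = (k + 1) * k.factorial := by
    rw [Nat.factorial_succ]; push_cast; ring
  have h3 : (k.factorial : 𝕜) ≠ 0 := by exact_mod_cast k.factorial_ne_zero
  have h4 : (k + 1 : 𝕜) ≠ 0 := by exact_mod_cast k.succ_ne_zero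
  rw [h1]
  simp only [lieTerm, smul_eq_mul, h2, ← Function.iterate_succ_apply, Nat.add_sub_cancel]
  push_cast
  field_simp
  ring

/-- If `X` and `Y` commute on an open set where `Y g = 0`, then `Y X g = 0` there. -/
theorem dirDeriv_dirDeriv_eq_zero [CompleteSpace E] {s : Set E} (hs : IsOpen s)
    (hX : AnalyticOnNhd 𝕜 X s)
    (hY : AnalyticOnNhd 𝕜 Y s) (hg : AnalyticOnNhd 𝕜 g s)
    (hXY : ∀ x ∈ s, VectorField.lieBracket 𝕜 X Y x = 0) (h0 : ∀ x ∈ s, fderiv 𝕜 g x (Y x) = 0)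
    (hx : x ∈ s) : fderiv 𝕜 (dirDeriv 𝕜 X g) x (Y x) = 0 := by
  have hgd := (hg x hx).fderiv.differentiableAt
  have h1 : fderiv 𝕜 (fun x => fderiv 𝕜 g x (Y x)) x = 0 := by
    have : (fun x => fderiv 𝕜 g x (Y x)) =ᶠ[𝓝 x] fun _ => 0 :=
      Filter.eventuallyEq_of_mem (hs.mem_nhds hx) h0
    rw [this.fderiv_eq]
    simp
  -- Symmetry of the second derivative gives `Y X g = X Y g - [X, Y] g`, and both terms on the right
  -- vanish.
  have hsymm : IsSymmSndFDerivAt 𝕜 g x :=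
    (hg x hx).contDiffAt.isSymmSndFDerivAt (n := ⊤) (by simp)
  have h2 := hXY x hx
  have hXd := (hX x hx).differentiableAt
  have hYd := (hY x hx).differentiableAt
  rw [VectorField.lieBracket_eq] at h2
  have h3 := fderiv_clm_apply hgd hYd
  rw [h1] at h3
  have h4 := congrArg (fun L => L (X x)) h3
  unfold dirDeriv
  rw [fderiv_clm_apply hgd hXd]
  have h5 : fderiv 𝕜 Y x (X x) = fderiv 𝕜 X x (Y x) := by
    simpa [sub_eq_zero] using h2
  have h6 := hsymm.eq (X x) (Y x)
  simp at h4 ⊢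
  rw [← h5, ← h6, ← h4]

/-- A function can be modified to a first integral of a vector field `X` transverse to
a hyperplane, without changing its differential along that hyperplane, and in such a way that
it stays a first integral of each field commuting with `X` and tangent to the hyperplanes. -/
theorem exists_firstIntegral [CompleteSpace E] (hX : AnalyticAt 𝕜 X y)
    (hℓ : ∀ᶠ x in 𝓝 y, ℓ (X x) = 1) (hg : AnalyticAt 𝕜 g y) :
    ∃ φ : E → 𝕜, AnalyticAt 𝕜 φ y ∧ (∀ᶠ x in 𝓝 y, fderiv 𝕜 φ x (X x) = 0) ∧
      (∀ v, ℓ v = 0 → fderiv 𝕜 φ y v = fderiv 𝕜 g y v) ∧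
      ∀ Y : E → E, AnalyticAt 𝕜 Y y → (∀ᶠ x in 𝓝 y, ℓ (Y x) = 0) →
        (∀ᶠ x in 𝓝 y, VectorField.lieBracket 𝕜 X Y x = 0) →
        (∀ᶠ x in 𝓝 y, fderiv 𝕜 g x (Y x) = 0) → ∀ᶠ x in 𝓝 y, fderiv 𝕜 φ x (Y x) = 0 := by
  obtain ⟨ρ₁, M, hρ₁, hXM⟩ := exists_majorizedAt_of_analyticAt hX
  obtain ⟨ρ₂, C, hρ₂, hgC⟩ := exists_majorizedAt_of_analyticAt hg
  obtain ⟨ρ₃, C', hρ₃, hgC'⟩ := exists_majorizedAt_of_analyticAt (analyticAt_dirDeriv hX hg)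
  set ρ := min ρ₁ (min ρ₂ ρ₃) with hρdef
  have hρ : 0 < ρ := by positivity
  replace hXM := hXM.mono hρ (min_le_left _ _) le_rfl
  replace hgC := hgC.mono hρ ((min_le_right _ _).trans (min_le_left _ _)) le_rfl
  replace hgC' := hgC'.mono hρ ((min_le_right _ _).trans (min_le_right _ _)) le_rfl
  have hM := hXM.nonneg
  set a := ‖ℓ‖ * (M * Real.exp 1 * 2 / ρ) with ha
  have ha0 : 0 ≤ a := by positivity
  -- The bound `ρ / 2` is what `majorizedAt_lieTerm` requires; the other one forces the ratio `q = a
  -- * ε` below `1`.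
  set ε := min (ρ / 2) (1 / (2 * (a + 1))) with hε
  have hε0 : 0 < ε := by positivity
  set q := ‖ℓ‖ * ε * (M * Real.exp 1 * 2 / ρ) with hq
  have hq0 : 0 ≤ q := by positivity
  have hq1 : q < 1 := by
    have h1 : q = a * ε := by rw [hq, ha]; ring
    have h2 : a * ε ≤ a * (1 / (2 * (a + 1))) := by gcongr; exact min_le_right _ _
    have h3 : a * (1 / (2 * (a + 1))) < 1 := by
      rw [mul_one_div, div_lt_one (by positivity)]
      linarith
    linarith
  have hgeom : Summable fun k : ℕ => q ^ k := summable_geometric_of_lt_one hq0 hq1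
  have hT := fun k => majorizedAt_lieTerm hXM hgC ℓ hε0 (min_le_left _ _) k
  have hT' := fun k => majorizedAt_lieTerm hXM hgC' ℓ hε0 (min_le_left _ _) k
  have hεlt : ε / 2 < ε := by linarith
  have hDT := fun k => (hT k).fderiv (ρ' := ε / 2) (by positivity) hεlt
  have hDsum : Summable fun k : ℕ => C * q ^ k / (ε - ε / 2) :=
    (hgeom.mul_left C).div_const _
  have hsub : Metric.ball y (ε / 2) ⊆ Metric.ball y ε := Metric.ball_subset_ball hεlt.le
  have hsubρ : Metric.ball y (ε / 2) ⊆ Metric.ball y ρ :=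
    Metric.ball_subset_ball (hεlt.le.trans ((min_le_left _ _).trans (by linarith)))
  have hφ := MajorizedAt.tsum hε0 hT (hgeom.mul_left C)
  have hy : y ∈ Metric.ball y (ε / 2) := Metric.mem_ball_self (by positivity)
  have hbdd : ∀ k, ∀ x ∈ Metric.ball y (ε / 2), ‖fderiv 𝕜 (lieTerm X ℓ y g k) x‖ ≤
      C * q ^ k / (ε - ε / 2) := fun k x hx => (hDT k).norm_le hx
  have hderiv : ∀ x ∈ Metric.ball y (ε / 2), ∀ w,
      HasSum (fun k => fderiv 𝕜 (lieTerm X ℓ y g k) x w)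
        (fderiv 𝕜 (fun x => ∑' k, lieTerm X ℓ y g k x) x w) := by
    intro x hx w
    have h1 : HasFDerivAt (fun x => ∑' k, lieTerm X ℓ y g k x)
        (∑' k, fderiv 𝕜 (lieTerm X ℓ y g k) x) x := by
      refine hasFDerivAt_tsum_of_isPreconnected hDsum Metric.isOpen_ball ?_ (fun k x hx => ?_)
        hbdd hy ?_ hx
      · let : NormedSpace ℝ E := NormedSpace.restrictScalars ℝ 𝕜 E
        exact (convex_ball y _).isPreconnected
      · exact ((hT k).analyticOnNhd x (hsub hx)).differentiableAt.hasFDerivAt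
      · exact Summable.of_norm_bounded (hgeom.mul_left C) fun k => (hT k).norm_le (hsub hy)
    rw [h1.fderiv]
    have h2 : Summable fun k => fderiv 𝕜 (lieTerm X ℓ y g k) x :=
      Summable.of_norm_bounded hDsum fun k => hbdd k x hx
    exact h2.hasSum.mapL (ContinuousLinearMap.apply 𝕜 𝕜 w)
  have hXan : AnalyticOnNhd 𝕜 X (Metric.ball y (ε / 2)) := hXM.analyticOnNhd.mono hsubρ
  have hgan : AnalyticOnNhd 𝕜 g (Metric.ball y (ε / 2)) := hgC.analyticOnNhd.mono hsubρ
  have hdiff : ∀ x ∈ Metric.ball y (ε / 2), ∀ k, DifferentiableAt 𝕜 ((dirDeriv 𝕜 X)^[k] g) x :=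
    fun x hx k => (analyticAt_dirDeriv_iterate (hXan x hx) (hgan x hx) k).differentiableAt
  have hball : ∀ᶠ x in 𝓝 y, x ∈ Metric.ball y (ε / 2) := Metric.ball_mem_nhds y (by positivity)
  refine ⟨_, hφ.analyticOnNhd y (hsub hy), ?_, fun v hv => ?_, fun Y hY hℓY hXY hgY => ?_⟩
  -- With `Sₖ` the Lie terms of `X g`, the derivative along `X` is `S₀ + ∑ (Sₖ₊₁ - Sₖ)`. It is zero
  -- because `∑ Sₖ` converges.
  · filter_upwards [hball, hℓ] with x hx hℓx
    have h1 := hderiv x hx (X x)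
    have hS : Summable fun k => lieTerm X ℓ y (dirDeriv 𝕜 X g) k x :=
      Summable.of_norm_bounded (hgeom.mul_left C') fun k => (hT' k).norm_le (hsub hx)
    refine h1.unique ?_
    rw [← hasSum_nat_add_iff' 1]
    simp only [Finset.sum_range_one,
      fderiv_lieTerm_zero_apply_self (show DifferentiableAt 𝕜 g x from hdiff x hx 0),
      fderiv_lieTerm_succ_apply_self (hdiff x hx _) hℓx]
    have h2 := (hasSum_nat_add_iff' 1).2 hS.hasSum
    simpa using h2.sub hS.hasSum
  -- At `y` the function `τ` vanishes, and so does its derivative along `v`; only the term `k = 0`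
  -- survives.
  · refine (hderiv y hy v).unique ?_
    have h1 : ∀ k, k ≠ 0 → fderiv 𝕜 (lieTerm X ℓ y g k) y v = 0 := fun k hk => by
      rw [fderiv_lieTerm_apply (hdiff y hy k), hv]
      simp [hk]
    have h2 := hasSum_single 0 h1
    rw [fderiv_lieTerm_apply (hdiff y hy 0), hv] at h2
    simpa using h2
  -- `Y` annihilates `τ` and, by commutation, every `Xᵏ g`, hence every term of the series.
  · obtain ⟨η, hη, hηs⟩ := Metric.eventually_nhds_iff_ball.1
      (hball.and (hY.eventually_analyticAt.and (hℓY.and (hXY.and hgY))))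
    have hzero : ∀ k, ∀ x ∈ Metric.ball y η, fderiv 𝕜 ((dirDeriv 𝕜 X)^[k] g) x (Y x) = 0 := by
      intro k
      induction k with
      | zero => exact fun x hx => (hηs x hx).2.2.2.2
      | succ k ih =>
        intro x hx
        rw [Function.iterate_succ_apply']
        exact dirDeriv_dirDeriv_eq_zero Metric.isOpen_ball (fun x hx => hXan x (hηs x hx).1)
          (fun x hx => (hηs x hx).2.1) (fun x hx => analyticAt_dirDeriv_iterate
            (hXan x (hηs x hx).1) (hgan x (hηs x hx).1) k)
          (fun x hx => (hηs x hx).2.2.2.1) ih hx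
    filter_upwards [Metric.ball_mem_nhds y hη] with x hx
    refine (hderiv x (hηs x hx).1 (Y x)).unique ?_
    convert! hasSum_zero with k
    rw [fderiv_lieTerm_apply (hdiff x (hηs x hx).1 k), hzero k x hx, (hηs x hx).2.2.1]
    simp

/-- Commuting fields `X₁, …, Xᵣ` with `ℓᵢ (Xⱼ) = δᵢⱼ` have a common first integral with prescribed
differential along the common kernel of the `ℓᵢ`. -/
theorem exists_common_firstIntegral [CompleteSpace E] {ι : Type*} [Fintype ι] [DecidableEq ι]
    {X : ι → E → E} {ℓ : ι → E →L[𝕜] 𝕜} (hX : ∀ i, AnalyticAt 𝕜 (X i) y)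
    (hℓ : ∀ i j, ∀ᶠ x in 𝓝 y, ℓ i (X j x) = if i = j then 1 else 0)
    (hcomm : ∀ i j, ∀ᶠ x in 𝓝 y, VectorField.lieBracket 𝕜 (X i) (X j) x = 0)
    (hg : AnalyticAt 𝕜 g y) :
    ∃ φ : E → 𝕜, AnalyticAt 𝕜 φ y ∧ (∀ i, ∀ᶠ x in 𝓝 y, fderiv 𝕜 φ x (X i x) = 0) ∧
      ∀ v, (∀ i, ℓ i v = 0) → fderiv 𝕜 φ y v = fderiv 𝕜 g y v := by
  -- Fields are treated one at a time. Correcting for `X i` preserves what holds for earlier `X j`,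
  -- which commute with `X i` and are tangent to the level sets of `ℓ i`.
  suffices ∀ s : Finset ι, ∃ φ : E → 𝕜, AnalyticAt 𝕜 φ y ∧
      (∀ i ∈ s, ∀ᶠ x in 𝓝 y, fderiv 𝕜 φ x (X i x) = 0) ∧
      ∀ v, (∀ i, ℓ i v = 0) → fderiv 𝕜 φ y v = fderiv 𝕜 g y v by
    simpa using this Finset.univ
  intro s
  induction s using Finset.induction_on with
  | empty => exact ⟨g, hg, by simp, fun _ _ => rfl⟩
  | insert i s his ih =>
    obtain ⟨φ, hφ, hφs, hφv⟩ := ih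
    obtain ⟨φ', hφ', hφi, hφv', hφY⟩ := exists_firstIntegral (ℓ := ℓ i) (hX i)
      (by simpa using hℓ i i) hφ
    refine ⟨φ', hφ', fun j hj => ?_, fun v hv => (hφv' v (hv i)).trans (hφv v hv)⟩
    rcases Finset.mem_insert.1 hj with rfl | hj
    · exact hφi
    · have hij : i ≠ j := fun h => his (h ▸ hj)
      exact hφY _ (hX j) (by simpa [hij] using hℓ i j) (hcomm i j) (hφs j hj)

end AnalyticMajorant

/-! ### From an involutive system to a commuting frame. -/

namespace AnalyticMajorant

variable {𝕜 : Type*} [RCLike 𝕜]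
  {E : Type*} [NormedAddCommGroup E] [NormedSpace 𝕜 E]
  {ι : Type*} [Fintype ι]

theorem analyticAt_lieBracket [CompleteSpace E] {V W : E → E} {y : E} (hV : AnalyticAt 𝕜 V y)
    (hW : AnalyticAt 𝕜 W y) : AnalyticAt 𝕜 (VectorField.lieBracket 𝕜 V W) y := by
  rw [VectorField.lieBracket_eq]
  exact (analyticAt_clm_apply hW.fderiv hV).sub
    (analyticAt_clm_apply hV.fderiv hW)

/-- The Leibniz terms that differentiate `c j` are multiples of `h j x`, so they stay in `S`. -/
theorem lieBracket_sum_smul_mem {S : Submodule 𝕜 E} {c : ι → E → 𝕜} {h : ι → E → E} {W : E → E}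
    {x : E} (hc : ∀ j, DifferentiableAt 𝕜 (c j) x) (hh : ∀ j, DifferentiableAt 𝕜 (h j) x)
    (hS : ∀ j, h j x ∈ S) (hb : ∀ j, VectorField.lieBracket 𝕜 (h j) W x ∈ S) :
    VectorField.lieBracket 𝕜 (fun x => ∑ j, c j x • h j x) W x ∈ S := by
  suffices ∀ s : Finset ι,
      VectorField.lieBracket 𝕜 (fun x => ∑ j ∈ s, c j x • h j x) W x ∈ S from this _
  classical
  intro s
  induction s using Finset.induction_on with
  | empty =>
    have : (fun x : E => ∑ j ∈ (∅ : Finset ι), c j x • h j x) = 0 := by ext; simp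
    rw [this, VectorField.lieBracket_zero_left]
    exact S.zero_mem
  | insert i s his ih =>
    have h1 : (fun x => ∑ j ∈ insert i s, c j x • h j x) =
        (fun x => c i x • h i x) + fun x => ∑ j ∈ s, c j x • h j x := by
      ext x
      simp [Finset.sum_insert his]
    have h2 : DifferentiableAt 𝕜 (fun x => ∑ j ∈ s, c j x • h j x) x :=
      DifferentiableAt.fun_sum fun j _ => (hc j).fun_smul (hh j)
    rw [h1, VectorField.lieBracket_add_left ((hc i).fun_smul (hh i)) h2]
    refine S.add_mem ?_ ih
    rw [VectorField.lieBracket_smul_left (hc i) (hh i)]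
    exact S.add_mem (S.smul_mem _ (hS i)) (S.smul_mem _ (hb i))

/-- The linear map `c ↦ ∑ⱼ cⱼ hⱼ(x)`. -/
noncomputable def frameMap (h : ι → E → E) (x : E) : (ι → 𝕜) →L[𝕜] E :=
  ∑ j, (ContinuousLinearMap.proj (R := 𝕜) (φ := fun _ : ι => 𝕜) j).smulRight (h j x)

theorem frameMap_apply (h : ι → E → E) (x : E) (c : ι → 𝕜) :
    frameMap h x c = ∑ j, c j • h j x := by
  simp [frameMap, sum_apply]

theorem mem_span_iff_frameMap {h : ι → E → E} {x v : E} :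
    v ∈ Submodule.span 𝕜 (range fun j => h j x) ↔ ∃ c : ι → 𝕜, frameMap h x c = v := by
  simp only [frameMap_apply]
  exact Submodule.mem_span_range_iff_exists_fun 𝕜

theorem analyticAt_frameMap {h : ι → E → E} {y : E} (hh : ∀ j, AnalyticAt 𝕜 (h j) y) :
    AnalyticAt 𝕜 (fun x => frameMap (𝕜 := 𝕜) h x) y := by
  unfold frameMap
  refine Finset.analyticAt_fun_sum _ fun j _ => ?_
  exact ((ContinuousLinearMap.smulRightL 𝕜 (ι → 𝕜) E
    (ContinuousLinearMap.proj (R := 𝕜) (φ := fun _ : ι => 𝕜) j)).analyticAt _).comp (hh j)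

/-- An analytic map which vanishes on a set that is dense near `y` vanishes near `y`. -/
theorem eventually_eq_zero_of_dense [CompleteSpace E] {F : Type*} [NormedAddCommGroup F]
    [NormedSpace 𝕜 F] [CompleteSpace F] {f : E → F} {y : E} {W : Set E} (hf : AnalyticAt 𝕜 f y)
    (hW : ∀ᶠ x in 𝓝 y, x ∈ closure W) (h0 : ∀ᶠ x in 𝓝 y, x ∈ W → f x = 0) :
    ∀ᶠ x in 𝓝 y, f x = 0 := by
  filter_upwards [hf.eventually_analyticAt, hW, h0.eventually_nhds] with x hx hxW hx0
  have h1 : ∃ᶠ z in 𝓝 x, f z ∈ ({0} : Set F) :=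
    ((mem_closure_iff_frequently.1 hxW).and_eventually hx0).mono fun z hz => hz.2 hz.1
  have h2 : f x ∈ closure ({0} : Set F) :=
    mem_closure_iff_frequently.2 (hx.continuousAt.tendsto.frequently h1)
  simpa using h2

/-- An involutive system of vector fields which is independent at `y` has, near `y`, a commuting
frame that is normalized by a given linear map `L`. -/
theorem exists_commuting_frame [DecidableEq ι] [CompleteSpace E] {h : ι → E → E} {y : E}
    {L : E →L[𝕜] (ι → 𝕜)}
    (hh : ∀ j, AnalyticAt 𝕜 (h j) y) (hL : ∀ j, L (h j y) = Pi.single j 1)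
    (hinv : ∀ i k, ∃ W : Set E, (∀ᶠ x in 𝓝 y, x ∈ closure W) ∧ ∀ᶠ x in 𝓝 y, x ∈ W →
      VectorField.lieBracket 𝕜 (h i) (h k) x ∈ Submodule.span 𝕜 (range fun j => h j x)) :
    ∃ X : ι → E → E, (∀ i, AnalyticAt 𝕜 (X i) y) ∧
      (∀ i, ∀ᶠ x in 𝓝 y, L (X i x) = Pi.single i 1) ∧
      (∀ i j, ∀ᶠ x in 𝓝 y, VectorField.lieBracket 𝕜 (X i) (X j) x = 0) ∧
      ∀ᶠ x in 𝓝 y, (LinearIndependent 𝕜 fun j => h j x) ∧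
        (∀ i, X i x ∈ Submodule.span 𝕜 (range fun j => h j x)) ∧
        ∀ j, h j x ∈ Submodule.span 𝕜 (range fun i => X i x) := by
  let H : E → (ι → 𝕜) →L[𝕜] E := fun x => frameMap h x
  have hH : AnalyticAt 𝕜 H y := analyticAt_frameMap hh
  let A : E → (ι → 𝕜) →L[𝕜] (ι → 𝕜) := fun x => L.comp (H x)
  have hA : AnalyticAt 𝕜 A y :=
    (((ContinuousLinearMap.compL 𝕜 (ι → 𝕜) E (ι → 𝕜)) L).analyticAt _).comp hH
  have hAy : A y = 1 := by
    ext c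
    simp [A, H, frameMap_apply, hL, Pi.single_apply]
  let B : E → (ι → 𝕜) →L[𝕜] (ι → 𝕜) := fun x => Ring.inverse (A x)
  have hB : AnalyticAt 𝕜 B y := by
    have h1 : AnalyticAt 𝕜 Ring.inverse (A y) := by
      rw [hAy]
      exact analyticAt_inverse (1 : ((ι → 𝕜) →L[𝕜] (ι → 𝕜))ˣ)
    exact h1.comp hA
  have hunit : ∀ᶠ x in 𝓝 y, IsUnit (A x) := by
    refine hA.continuousAt.eventually (Units.isOpen.mem_nhds ?_)
    rw [hAy]
    exact isUnit_one
  have hAB : ∀ᶠ x in 𝓝 y, ∀ c, L (H x (B x c)) = c := hunit.mono fun x hx c =>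
    congrArg (fun T => T c) (Ring.mul_inverse_cancel _ hx)
  have hBA : ∀ᶠ x in 𝓝 y, ∀ c, B x (L (H x c)) = c := hunit.mono fun x hx c =>
    congrArg (fun T => T c) (Ring.inverse_mul_cancel _ hx)
  -- The columns of `H A⁻¹`: the frame normalized so that `L` sends it to the standard basis near
  -- `y`.
  let X : ι → E → E := fun i x => H x (B x (Pi.single i 1))
  have hBe : ∀ i, AnalyticAt 𝕜 (fun x => B x (Pi.single i 1)) y := fun i =>
    analyticAt_clm_apply hB analyticAt_const
  have hX : ∀ i, AnalyticAt 𝕜 (X i) y := fun i => analyticAt_clm_apply hH (hBe i)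
  have hLX : ∀ i, ∀ᶠ x in 𝓝 y, L (X i x) = Pi.single i 1 := fun i => hAB.mono fun x hx => hx _
  have hhinv : ∀ i k, ∀ᶠ x in 𝓝 y,
      VectorField.lieBracket 𝕜 (h i) (h k) x ∈ Submodule.span 𝕜 (range fun j => h j x) := by
    intro i k
    obtain ⟨W, hW, hWb⟩ := hinv i k
    have hbr := analyticAt_lieBracket (hh i) (hh k)
    -- `H B L` projects onto the span along the kernel of `L`. The bracket minus its projection is
    -- analytic and vanishes on the dense set, hence everywhere near `y`.
    have hQ := hbr.sub (analyticAt_clm_apply hH (analyticAt_clm_apply hB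
      ((L.analyticAt _).comp hbr)))
    refine (eventually_eq_zero_of_dense hQ hW ?_).mono fun x hx => ?_
    · filter_upwards [hWb, hBA] with x hx hBAx hxW
      obtain ⟨c, hc⟩ := mem_span_iff_frameMap.1 (hx hxW)
      simp only [Pi.sub_apply, Function.comp_apply, ← hc]
      rw [sub_eq_zero]
      exact congrArg (H x) (hBAx c).symm
    · exact mem_span_iff_frameMap.2 ⟨_, (sub_eq_zero.1 hx).symm⟩
  refine ⟨X, hX, hLX, fun i k => ?_, ?_⟩
  · have hXeq : ∀ i, X i = fun x => ∑ j, B x (Pi.single i 1) j • h j x := fun i => by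
      ext1 x
      exact frameMap_apply _ _ _
    have hcan : ∀ i j, AnalyticAt 𝕜 (fun x => B x (Pi.single i 1) j) y := fun i j =>
      ((ContinuousLinearMap.proj (R := 𝕜) (φ := fun _ : ι => 𝕜) j).analyticAt _).comp (hBe i)
    have hall := eventually_all.2 fun i => eventually_all.2 fun k => hhinv i k
    filter_upwards [hall, hBA, (hLX i).eventually_nhds, (hLX k).eventually_nhds,
      eventually_all.2 fun j => (hh j).eventually_analyticAt,
      eventually_all.2 fun i => eventually_all.2 fun j => (hcan i j).eventually_analyticAt,
      eventually_all.2 fun j => (hX j).eventually_analyticAt]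
      with x hinvx hBAx hLi hLk hhx hcx hXx
    have hmem : ∀ j, h j x ∈ Submodule.span 𝕜 (range fun j => h j x) := fun j =>
      Submodule.subset_span ⟨j, rfl⟩
    have h1 : VectorField.lieBracket 𝕜 (X i) (X k) x ∈
        Submodule.span 𝕜 (range fun j => h j x) := by
      rw [hXeq i]
      refine lieBracket_sum_smul_mem (fun j => (hcx i j).differentiableAt)
        (fun j => (hhx j).differentiableAt) hmem fun j => ?_
      rw [VectorField.lieBracket_swap, hXeq k]
      refine Submodule.neg_mem _ (lieBracket_sum_smul_mem (fun j => (hcx k j).differentiableAt)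
        (fun j => (hhx j).differentiableAt) hmem fun l => hinvx l j)
    -- `L (X i)` is locally constant, so `L` kills both terms of the bracket. On the span `L` is
    -- injective by `hBA`, so the bracket is zero.
    have hconst : ∀ i, (∀ᶠ z in 𝓝 x, L (X i z) = Pi.single i 1) → ∀ v,
        L (fderiv 𝕜 (X i) x v) = 0 := by
      intro i hi v
      have h2 : HasFDerivAt (fun z => L (X i z)) (L.comp (fderiv 𝕜 (X i) x)) x :=
        L.hasFDerivAt.comp x (hXx i).differentiableAt.hasFDerivAt
      have h3 : HasFDerivAt (fun z => L (X i z)) (0 : E →L[𝕜] (ι → 𝕜)) x :=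
        (hasFDerivAt_const _ x).congr_of_eventuallyEq hi
      exact congrArg (fun T => T v) (h2.unique h3)
    obtain ⟨c, hc⟩ := mem_span_iff_frameMap.1 h1
    have h4 : L (VectorField.lieBracket 𝕜 (X i) (X k) x) = 0 := by
      rw [VectorField.lieBracket_eq]
      simp [hconst i hLi, hconst k hLk]
    have h5 : c = 0 := by
      rw [← hBAx c]
      have : L (H x c) = 0 := by rw [← h4, ← hc]
      rw [this, map_zero]
    rw [← hc, h5, map_zero]
  · filter_upwards [hBA] with x hx
    refine ⟨?_, fun i => mem_span_iff_frameMap.2 ⟨_, rfl⟩, fun j => ?_⟩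
    · rw [Fintype.linearIndependent_iff]
      intro c hc
      have h1 : H x c = 0 := by rw [← hc]; exact frameMap_apply _ _ _
      have h2 := hx c
      rw [h1, map_zero, map_zero] at h2
      exact fun i => congrFun h2.symm i
    · refine mem_span_iff_frameMap.2 ⟨L (h j x), ?_⟩
      have h1 : h j x = H x (Pi.single j 1) := by simp [H, frameMap_apply, Pi.single_apply]
      have h2 : ∀ c : ι → 𝕜, H x (B x c) = ∑ i, c i • X i x := fun c => by
        conv_lhs => rw [pi_eq_sum_univ' c]
        simp only [map_sum, map_smul, X]
      rw [frameMap_apply, ← h2, h1, hx]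

end AnalyticMajorant

/-! ### The Frobenius chart. -/

namespace AnalyticMajorant

variable {𝕜 : Type*} [RCLike 𝕜]

/-- Linearly independent vectors `v₁, …, vᵣ` are the first coordinate vectors of some linear
coordinate system `(L, T)`. -/
theorem exists_linear_coordinates {n r : ℕ} {v : Fin r → Fin n → 𝕜} (hv : LinearIndependent 𝕜 v) :
    ∃ (L : (Fin n → 𝕜) →L[𝕜] (Fin r → 𝕜)) (T : (Fin n → 𝕜) →L[𝕜] (Fin (n - r) → 𝕜)),
      (∀ j, L (v j) = Pi.single j 1) ∧ ∀ w, L w = 0 → T w = 0 → w = 0 := by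
  let H : (Fin r → 𝕜) →ₗ[𝕜] (Fin n → 𝕜) := Fintype.linearCombination 𝕜 v
  have hH : LinearMap.ker H = ⊥ :=
    LinearMap.ker_eq_bot.2 (hv.fintypeLinearCombination_injective)
  obtain ⟨L, hL⟩ := LinearMap.exists_leftInverse_of_injective H hH
  have hLH : ∀ c, L (H c) = c := fun c => congrArg (fun A => A c) hL
  have hsurj : Function.Surjective L := fun c => ⟨H c, hLH c⟩
  have hrank : Module.finrank 𝕜 (LinearMap.ker L) = Module.finrank 𝕜 (Fin (n - r) → 𝕜) := by
    have := LinearMap.finrank_range_add_finrank_ker L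
    rw [LinearMap.range_eq_top.2 hsurj, finrank_top] at this
    simp only [Module.finrank_fin_fun] at this ⊢
    lia
  -- `T` extends an isomorphism from the kernel of `L` onto the remaining coordinates, so `L` and
  -- `T` have no common kernel.
  let κ := LinearEquiv.ofFinrankEq _ _ hrank
  obtain ⟨T, hT⟩ := LinearMap.exists_extend (p := LinearMap.ker L) κ.toLinearMap
  refine ⟨LinearMap.toContinuousLinearMap L, LinearMap.toContinuousLinearMap T, fun j => ?_,
    fun w hw hTw => ?_⟩
  · have := hLH (Pi.single j 1)
    rwa [Fintype.linearCombination_apply_single, one_smul] at this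
  · have h1 : T w = κ ⟨w, hw⟩ := congrArg (fun A => A ⟨w, hw⟩) hT
    have h2 : κ ⟨w, hw⟩ = 0 := h1.symm.trans hTw
    exact congrArg Subtype.val (κ.map_eq_zero_iff.1 h2)

/-- A function on an open set whose differential vanishes on the first factor of a product of balls
depends only on the second factor. -/
theorem eq_of_fderiv_inl_eq_zero {F G : Type*} [NormedAddCommGroup F] [NormedSpace 𝕜 F]
    [NormedAddCommGroup G] [NormedSpace 𝕜 G] {f : F × G → 𝕜} {a₀ : F} {b₀ : G} {ε : ℝ}
    (hf : ∀ w ∈ Metric.ball (a₀, b₀) ε, DifferentiableAt 𝕜 f w)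
    (h0 : ∀ w ∈ Metric.ball (a₀, b₀) ε, ∀ u, fderiv 𝕜 f w (u, 0) = 0) {a : F} {b : G}
    (hab : (a, b) ∈ Metric.ball (a₀, b₀) ε) : f (a, b) = f (a₀, b) := by
  rw [← ball_prod_same] at hf h0 hab
  have hε : 0 < ε := dist_nonneg.trans_lt (Metric.mem_ball.1 hab.1)
  let : NormedSpace ℝ F := NormedSpace.restrictScalars ℝ 𝕜 F
  have hd : ∀ u ∈ Metric.ball a₀ ε,
      HasFDerivAt (fun u => f (u, b)) ((fderiv 𝕜 f (u, b)).comp (ContinuousLinearMap.inl 𝕜 F G)) u :=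
    fun u hu => (hf (u, b) ⟨hu, hab.2⟩).hasFDerivAt.comp u (hasFDerivAt_prodMk_left u b)
  refine Metric.isOpen_ball.is_const_of_fderiv_eq_zero (𝕜 := 𝕜) (f := fun u => f (u, b))
    (convex_ball a₀ ε).isPreconnected (fun u hu => (hd u hu).differentiableAt.differentiableWithinAt)
    (fun u hu => ?_) hab.1 (Metric.mem_ball_self hε)
  rw [(hd u hu).fderiv]
  ext v
  exact h0 (u, b) ⟨hu, hab.2⟩ v

/-- The analytic Frobenius theorem: near `y`, common first integrals of an involutive system that is
independent at `y` are coordinate functions of an analytic chart `Φ = (L, φ)`, whose first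
coordinate directions are spanned by the system. -/
theorem exists_frobenius_chart {n r : ℕ} {h : Fin r → (Fin n → 𝕜) → (Fin n → 𝕜)} {y : Fin n → 𝕜}
    (hh : ∀ j, AnalyticAt 𝕜 (h j) y) (hli : LinearIndependent 𝕜 fun j => h j y)
    (hinv : ∀ i k, ∃ W : Set (Fin n → 𝕜), (∀ᶠ x in 𝓝 y, x ∈ closure W) ∧ ∀ᶠ x in 𝓝 y, x ∈ W →
      VectorField.lieBracket 𝕜 (h i) (h k) x ∈ Submodule.span 𝕜 (range fun j => h j x))
    {N : Set (Fin n → 𝕜)} (hN : N ∈ 𝓝 y) :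
    ∃ (Φ : OpenPartialHomeomorph (Fin n → 𝕜) ((Fin r → 𝕜) × (Fin (n - r) → 𝕜)))
      (L : (Fin n → 𝕜) →L[𝕜] (Fin r → 𝕜)) (φ : Fin (n - r) → (Fin n → 𝕜) → 𝕜) (ε : ℝ),
      0 < ε ∧ y ∈ Φ.source ∧ Metric.ball (Φ y) ε ⊆ Φ.target ∧ (∀ x, Φ x = (L x, fun j => φ j x)) ∧
      ∀ w ∈ Metric.ball (Φ y) ε, AnalyticAt 𝕜 Φ.symm w ∧ Φ.symm w ∈ N ∧
        LinearIndependent 𝕜 (fun j => h j (Φ.symm w)) ∧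
        (∀ j, AnalyticAt 𝕜 (φ j) (Φ.symm w)) ∧
        (∀ j i, fderiv 𝕜 (φ j) (Φ.symm w) (h i (Φ.symm w)) = 0) ∧
        ∀ u, ∃ v ∈ Submodule.span 𝕜 (range fun j => h j (Φ.symm w)),
          fderiv 𝕜 Φ (Φ.symm w) v = (u, 0) := by
  obtain ⟨L, T, hL, hLT⟩ := exists_linear_coordinates hli
  obtain ⟨X, hX, hLX, hcomm, hspan⟩ := exists_commuting_frame hh hL hinv
  have hφex := fun m : Fin (n - r) => exists_common_firstIntegral (g := fun x => T x m)
    (ℓ := fun i => (ContinuousLinearMap.proj (R := 𝕜) (φ := fun _ : Fin r => 𝕜) i).comp L) hX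
    (fun i j => (hLX j).mono fun x hx => by
      simp only [ContinuousLinearMap.comp_apply, hx]
      simp [Pi.single_apply]) hcomm
    (((ContinuousLinearMap.proj (R := 𝕜) (φ := fun _ : Fin (n - r) => 𝕜) m).comp T).analyticAt y)
  choose φ hφ hφX hφT using hφex
  let Φ₀ : (Fin n → 𝕜) → (Fin r → 𝕜) × (Fin (n - r) → 𝕜) := fun x => (L x, fun j => φ j x)
  have hΦan : ∀ {x}, (∀ j, AnalyticAt 𝕜 (φ j) x) → AnalyticAt 𝕜 Φ₀ x := fun hx =>
    (L.analyticAt _).prod (AnalyticAt.pi hx)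
  have hΦd : ∀ {x}, (∀ j, AnalyticAt 𝕜 (φ j) x) → ∀ v,
      fderiv 𝕜 Φ₀ x v = (L v, fun j => fderiv 𝕜 (φ j) x v) := fun {x} hx v => by
    have h1 : HasFDerivAt Φ₀ (L.prod (ContinuousLinearMap.pi fun j => fderiv 𝕜 (φ j) x)) x :=
      L.hasFDerivAt.prodMk (hasFDerivAt_pi.2 fun j => (hx j).differentiableAt.hasFDerivAt)
    rw [h1.fderiv]
    rfl
  -- On the kernel of `L` the differentials of the `φ m` at `y` are the components of `T`, and `(L,
  -- T)` is injective.
  have hinj : Function.Injective (fderiv 𝕜 Φ₀ y).toLinearMap := by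
    rw [← LinearMap.ker_eq_bot, LinearMap.ker_eq_bot']
    intro v hv
    have h1 : fderiv 𝕜 Φ₀ y v = 0 := hv
    rw [hΦd hφ, Prod.mk_eq_zero] at h1
    refine hLT v h1.1 ?_
    ext m
    have h2 := hφT m v fun i => by simp [h1.1]
    have h3 : fderiv 𝕜 (fun x => T x m) y v = T v m := by
      have : HasFDerivAt (fun x => T x m)
        ((ContinuousLinearMap.proj (R := 𝕜) (φ := fun _ : Fin (n - r) => 𝕜) m).comp T) y :=
        ((ContinuousLinearMap.proj (R := 𝕜) (φ := fun _ : Fin (n - r) => 𝕜) m).comp T).hasFDerivAt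
      rw [this.fderiv]
      rfl
    rw [← h3, ← h2]
    exact congrFun h1.2 m
  have hrn : r ≤ n := by simpa using hli.fintype_card_le_finrank
  have hrank : Module.finrank 𝕜 (Fin n → 𝕜) =
      Module.finrank 𝕜 ((Fin r → 𝕜) × (Fin (n - r) → 𝕜)) := by
    simp [hrn]
  let D : (Fin n → 𝕜) ≃L[𝕜] (Fin r → 𝕜) × (Fin (n - r) → 𝕜) :=
    (LinearEquiv.ofInjectiveOfFinrankEq _ hinj hrank).toContinuousLinearEquiv
  have hD : fderiv 𝕜 Φ₀ y = D := by
    ext1 v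
    rfl
  have hstrict : HasStrictFDerivAt Φ₀ (D : (Fin n → 𝕜) →L[𝕜] _) y := by
    rw [← hD]
    exact (hΦan hφ).hasStrictFDerivAt
  let Φ := hstrict.toOpenPartialHomeomorph Φ₀
  have hys : y ∈ Φ.source := hstrict.mem_toOpenPartialHomeomorph_source
  have hsymm : AnalyticAt 𝕜 Φ.symm (Φ y) := Φ.analyticAt_symm' hys (hΦan hφ) hD
  have hgood : ∀ᶠ x in 𝓝 y, x ∈ N ∧ LinearIndependent 𝕜 (fun j => h j x) ∧
      (∀ j, AnalyticAt 𝕜 (φ j) x) ∧ (∀ j i, fderiv 𝕜 (φ j) x (h i x) = 0) ∧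
      ∀ u, ∃ v ∈ Submodule.span 𝕜 (range fun j => h j x), fderiv 𝕜 Φ x v = (u, 0) := by
    filter_upwards [hN, hspan, eventually_all.2 fun j => (hφ j).eventually_analyticAt,
      eventually_all.2 fun j => eventually_all.2 fun i => hφX j i, eventually_all.2 hLX]
      with x hxN hxspan hxφ hxX hxL
    -- The vector `∑ uᵢ Xᵢ` is sent to `(u, 0)`, since `L (X i) = eᵢ` and every `φ j` is constant
    -- along `X i`.
    refine ⟨hxN, hxspan.1, hxφ, fun j i => ?_, fun u => ⟨∑ i, u i • X i x,
      Submodule.sum_mem _ fun i _ => Submodule.smul_mem _ _ (hxspan.2.1 i), ?_⟩⟩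
    · have h1 : Submodule.span 𝕜 (range fun i => X i x) ≤
          LinearMap.ker (fderiv 𝕜 (φ j) x).toLinearMap := by
        rw [Submodule.span_le]
        rintro _ ⟨i, rfl⟩
        exact hxX j i
      exact h1 (hxspan.2.2 i)
    · change fderiv 𝕜 Φ₀ x _ = _
      rw [hΦd hxφ]
      ext k
      · simp [map_sum, hxL, Finset.sum_apply, Pi.single_apply]
      · simp [map_sum, hxX]
  have hgood' : ∀ᶠ w in 𝓝 (Φ y), Φ.symm w ∈ N ∧
      LinearIndependent 𝕜 (fun j => h j (Φ.symm w)) ∧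
      (∀ j, AnalyticAt 𝕜 (φ j) (Φ.symm w)) ∧
      (∀ j i, fderiv 𝕜 (φ j) (Φ.symm w) (h i (Φ.symm w)) = 0) ∧
      ∀ u, ∃ v ∈ Submodule.span 𝕜 (range fun j => h j (Φ.symm w)),
        fderiv 𝕜 Φ (Φ.symm w) v = (u, 0) := by
    have h1 := hsymm.continuousAt.tendsto
    rw [Φ.left_inv hys] at h1
    exact h1.eventually hgood
  obtain ⟨ε, hε, hball⟩ := Metric.eventually_nhds_iff_ball.1
    ((Φ.open_target.eventually_mem (Φ.map_source hys)).and
      (hsymm.eventually_analyticAt.and hgood'))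
  exact ⟨Φ, L, φ, ε, hε, hys, fun w hw => (hball w hw).1, fun _ => rfl, fun w hw => (hball w hw).2⟩

end AnalyticMajorant

/-! ### First integrals near a point of independence. -/

theorem theorem3p4 {𝕜 : Type*} [RCLike 𝕜] {n r : ℕ} (hr : 1 ≤ r) (hrn : r < n)
    (U : Set (Fin n → 𝕜)) (hU : IsOpen U) (hUc : IsConnected U)
    (f : (Fin n → 𝕜) → (Fin n → 𝕜)) (hf : AnalyticOnNhd 𝕜 f U)
    (Us : Set (Fin n → 𝕜)) (hUsU : Us ⊆ U) (hUs : IsOpen Us) (hUsc : IsConnected Us)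
    (h : Fin r → (Fin n → 𝕜) → (Fin n → 𝕜))
    (hh : ∀ i, h i ∈ AnalyticVectorField.centralizer Us f)
    (hind : AnalyticVectorField.LinearIndependentOverMeromorphic Us h)
    (μ : Fin r → Fin r → Fin r → (Fin n → 𝕜) → 𝕜)
    (hμ : ∀ i k l, AnalyticVectorField.IsMeromorphic Us (μ i k l))
    (hinv : ∀ i k, AnalyticVectorField.HoldsGenerically Us (fun x =>
      VectorField.lieBracket 𝕜 (h i) (h k) x = ∑ l, μ i k l x • h l x)) :
    ∀ y ∈ AnalyticVectorField.independenceSet Us h,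
      ∃ V : Set (Fin n → 𝕜), IsOpen V ∧ IsConnected V ∧ y ∈ V ∧
        V ⊆ AnalyticVectorField.independenceSet Us h ∧
        ∃ φ : Fin (n - r) → (Fin n → 𝕜) → 𝕜,
          (∀ j, AnalyticOnNhd 𝕜 (φ j) V) ∧
          AnalyticVectorField.FunctionallyIndependent V φ ∧
          (∀ j, AnalyticVectorField.IsCommonFirstIntegral V h (φ j)) ∧
          ∀ ψ : (Fin n → 𝕜) → 𝕜, AnalyticVectorField.IsCommonFirstIntegral V h ψ →
            ∃ σ : (Fin (n - r) → 𝕜) → 𝕜,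
              AnalyticOnNhd 𝕜 σ ((fun x j => φ j x) '' V) ∧
              ∀ x ∈ V, ψ x = σ (fun j => φ j x) := by
  rintro y ⟨hyU, hyli⟩
  have hUsy := hUs.mem_nhds hyU
  obtain ⟨Φ, L, φ, ε, hε, hys, htarget, hΦ, hball⟩ :=
    AnalyticMajorant.exists_frobenius_chart (fun j => (hh j).1 y hyU) hyli (fun i k => by
      obtain ⟨W, -, -, hUW, hW⟩ := hinv i k
      refine ⟨W, mem_of_superset hUsy hUW, Eventually.of_forall fun x hx => ?_⟩
      rw [hW x hx]
      exact Submodule.sum_mem _ fun l _ =>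
        Submodule.smul_mem _ _ (Submodule.subset_span ⟨l, rfl⟩)) hUsy
  -- In the chart, `V` is a ball for the sup norm of the product, that is, a product of balls:
  -- convex, and sliced by `φ` into connected pieces.
  let V := Φ.source ∩ Φ ⁻¹' Metric.ball (Φ y) ε
  have hVopen : IsOpen V := Φ.isOpen_inter_preimage Metric.isOpen_ball
  have hyV : y ∈ V := ⟨hys, Metric.mem_ball_self hε⟩
  have hVimage : V = Φ.symm '' Metric.ball (Φ y) ε := by
    ext x
    constructor
    · exact fun hx => ⟨Φ x, hx.2, Φ.left_inv hx.1⟩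
    · rintro ⟨w, hw, rfl⟩
      refine ⟨Φ.map_target (htarget hw), ?_⟩
      rwa [mem_preimage, Φ.right_inv (htarget hw)]
  have hVconn : IsConnected V := by
    rw [hVimage]
    refine IsConnected.image ?_ _ (Φ.continuousOn_symm.mono htarget)
    exact (convex_ball (Φ y) ε).isConnected ⟨_, Metric.mem_ball_self hε⟩
  have hV : ∀ x ∈ V, AnalyticAt 𝕜 Φ.symm (Φ x) ∧ x ∈ Us ∧
      LinearIndependent 𝕜 (fun j => h j x) ∧ (∀ j, AnalyticAt 𝕜 (φ j) x) ∧
      (∀ j i, fderiv 𝕜 (φ j) x (h i x) = 0) ∧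
      ∀ u, ∃ v ∈ Submodule.span 𝕜 (range fun j => h j x), fderiv 𝕜 Φ x v = (u, 0) := by
    intro x hx
    have := hball (Φ x) hx.2
    rwa [Φ.left_inv hx.1] at this
  have hΦd : ∀ x ∈ V, HasFDerivAt Φ
      (L.prod (ContinuousLinearMap.pi fun j => fderiv 𝕜 (φ j) x)) x := fun x hx => by
    have h1 : (Φ : (Fin n → 𝕜) → _) = fun x => (L x, fun j => φ j x) := funext hΦ
    rw [h1]
    exact L.hasFDerivAt.prodMk
      (hasFDerivAt_pi.2 fun j => ((hV x hx).2.2.2.1 j).differentiableAt.hasFDerivAt)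
  have hright : ∀ x ∈ V, ∀ u, fderiv 𝕜 Φ x (fderiv 𝕜 Φ.symm (Φ x) u) = u := fun x hx u => by
    have h1 : HasFDerivAt (Φ ∘ Φ.symm) ((fderiv 𝕜 Φ x).comp (fderiv 𝕜 Φ.symm (Φ x))) (Φ x) := by
      refine HasFDerivAt.comp _ ?_ (hV x hx).1.differentiableAt.hasFDerivAt
      rw [Φ.left_inv hx.1]
      exact (hΦd x hx).differentiableAt.hasFDerivAt
    have h2 : HasFDerivAt (Φ ∘ Φ.symm) (ContinuousLinearMap.id 𝕜 _) (Φ x) :=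
      (hasFDerivAt_id _).congr_of_eventuallyEq (Φ.eventually_right_inverse (Φ.map_source hx.1))
    exact congrArg (fun A => A u) (h1.unique h2)
  have hleft : ∀ x ∈ V, ∀ v, fderiv 𝕜 Φ.symm (Φ x) (fderiv 𝕜 Φ x v) = v := fun x hx v => by
    have h1 : HasFDerivAt (Φ.symm ∘ Φ) ((fderiv 𝕜 Φ.symm (Φ x)).comp (fderiv 𝕜 Φ x)) x :=
      (hV x hx).1.differentiableAt.hasFDerivAt.comp x (hΦd x hx).differentiableAt.hasFDerivAt
    have h2 : HasFDerivAt (Φ.symm ∘ Φ) (ContinuousLinearMap.id 𝕜 _) x :=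
      (hasFDerivAt_id _).congr_of_eventuallyEq (Φ.eventually_left_inverse hx.1)
    exact congrArg (fun A => A v) (h1.unique h2)
  have hindep : AnalyticVectorField.FunctionallyIndependent V φ := by
    intro x hx
    rw [Fintype.linearIndependent_iff]
    intro c hc j
    -- The preimage of `(0, eⱼ)` under the differential of the chart is dual to the differentials of
    -- the `φ i`, so it isolates `c j`.
    have h1 := hright x hx (0, Pi.single j 1)
    rw [(hΦd x hx).fderiv] at h1
    have h2 : ∀ i, fderiv 𝕜 (φ i) x (fderiv 𝕜 Φ.symm (Φ x) (0, Pi.single j 1)) =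
        Pi.single (M := fun _ => 𝕜) j 1 i := fun i => congrFun (congrArg Prod.snd h1) i
    have h3 := congrArg (fun A => A (fderiv 𝕜 Φ.symm (Φ x) (0, Pi.single j 1))) hc
    simpa [sum_apply, h2, Pi.single_apply] using h3
  refine ⟨V, hVopen, hVconn, hyV, fun x hx => ⟨(hV x hx).2.1, (hV x hx).2.2.1⟩, φ,
    fun j x hx => (hV x hx).2.2.2.1 j, hindep, fun j i => ⟨fun x hx => (hV x hx).2.2.2.1 j, ?_,
      fun x hx => (hV x hx).2.2.2.2.1 j i⟩, fun ψ hψ => ?_⟩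
  · rintro ⟨c, hc⟩
    refine (hindep y hyV).ne_zero j ?_
    have h1 : φ j =ᶠ[𝓝 y] fun _ => c := eventuallyEq_of_mem (hVopen.mem_nhds hyV) hc
    simp [h1.fderiv_eq]
  -- Some field must exist for `ψ` to be known analytic; `1 ≤ r` supplies the index `0`.
  · have hψan : AnalyticOnNhd 𝕜 ψ V := (hψ ⟨0, hr⟩).analytic
    have hmem : ∀ w ∈ Metric.ball (Φ y) ε, Φ.symm w ∈ V := fun w hw => by
      rw [hVimage]
      exact ⟨w, hw, rfl⟩
    have hFan : ∀ w ∈ Metric.ball (Φ y) ε, AnalyticAt 𝕜 (ψ ∘ Φ.symm) w := fun w hw =>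
      (hψan _ (hmem w hw)).comp (hball w hw).1
    -- The direction `(u, 0)` is the image of a vector in the span of the `h j`, along which `ψ` has
    -- zero derivative.
    have hF0 : ∀ w ∈ Metric.ball (Φ y) ε, ∀ u, fderiv 𝕜 (ψ ∘ Φ.symm) w (u, 0) = 0 := by
      intro w hw u
      have hx := hmem w hw
      obtain ⟨v, hv, hvu⟩ := (hV _ hx).2.2.2.2.2 u
      have h1 := hleft _ hx v
      rw [hvu, Φ.right_inv (htarget hw)] at h1
      rw [fderiv_comp w (hψan _ hx).differentiableAt (hball w hw).1.differentiableAt]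
      change fderiv 𝕜 ψ (Φ.symm w) (fderiv 𝕜 Φ.symm w (u, 0)) = 0
      rw [h1]
      have h2 : Submodule.span 𝕜 (range fun j => h j (Φ.symm w)) ≤
          LinearMap.ker (fderiv 𝕜 ψ (Φ.symm w)).toLinearMap := by
        rw [Submodule.span_le]
        rintro _ ⟨i, rfl⟩
        exact (hψ i).lieDerivative_eq_zero _ hx
      exact h2 hv
    have hcoord : ∀ x ∈ V, (L y, fun j => φ j x) ∈ Metric.ball (Φ y) ε := fun x hx => by
      have h1 := hx.2
      rw [mem_preimage, hΦ x, hΦ y, ← ball_prod_same] at h1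
      rw [hΦ y, ← ball_prod_same]
      exact ⟨Metric.mem_ball_self hε, h1.2⟩
    -- `σ` is `ψ` restricted to the transversal through `y` on which `L` is constant, read in the
    -- coordinates `φ`.
    refine ⟨fun b => ψ (Φ.symm (L y, b)), ?_, fun x hx => ?_⟩
    · rintro _ ⟨x, hx, rfl⟩
      exact (hFan _ (hcoord x hx)).comp (analyticAt_const.prod analyticAt_id)
    · have hy := hΦ y
      have h1 := hx.2
      rw [mem_preimage, hΦ x] at h1
      rw [hy] at h1 hFan hF0
      have h2 := AnalyticMajorant.eq_of_fderiv_inl_eq_zero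
        (fun w hw => (hFan w hw).differentiableAt) hF0 h1
      rw [Function.comp_apply, Function.comp_apply, ← hΦ x, Φ.left_inv hx.1] at h2
      exact h2
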